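/- Let $J=\begin{pmatrix}0&I_n\\-I_n&0\end{pmatrix}$ and let $\mathrm{Sp}(n)=\{A\in \mathrm U(2n) : A^{T}JA=J\}$ act on the density matrices on $\mathbb C^{2n}$ (positive semidefinite $2n\times 2n$ complex matrices of trace one) by conjugation, $g\cdot\rho=g\rho g^{-1}$. Let $\rho=\mathrm{diag}(\lambda_1,\dots,\lambda_{2n})$ be a diagonal density matrix, i.e. $0\le\lambda_i\le 1$ and $\sum_{i=1}^{2n}\lambda_i=1$. Then: 1. The group $T^n=\{\mathrm{diag}(z_1,\dots,z_n,\bar z_1,\dots,\bar z_n) : z_i\in\mathbb C,\ |z_i|=1\}$ is isomorphic as a topological group to $\mathrm U(1)^n$, it is a maximal torus of $\mathrm{Sp}(n)$, and it is contained in the stabilizer of $\rho$ in $\mathrm{Sp}(n)$. 2. The orbit $\mathrm{Sp}(n)\cdot\rho$ is a homogeneous manifold of real dimension at most $2n^2$. That is, for some $d\le 2n^2$ the orbit, with its subspace topology, carries the structure of a smooth $d$-dimensional manifold without boundary that is smoothly embedded in the real vector space of complex $2n\times 2n$ matrices; the Lie group $\mathrm{Sp}(n)$ (with its smooth structure as an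 embedded submanifold of the matrices) acts smoothly and transitively on it; and the orbit is canonically homeomorphic to the quotient of $\mathrm{Sp}(n)$ by the stabilizer of $\rho$. -/

import Mathlib

open scoped Matrix Manifold ContDiff ComplexOrder

noncomputable section

namespace SymplecticOrbit

/-- The matrix `J` with blocks `0, I, -I, 0`; the `2n` indices are split into two halves. -/
def J (n : ℕ) : Matrix (Fin n ⊕ Fin n) (Fin n ⊕ Fin n) ℂ :=
  Matrix.fromBlocks 0 1 (-1) 0

/-- The compact symplectic group `Sp(n)`: all `A` in `U(2n)` with `Aᵀ J A = J`. -/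
def Sp (n : ℕ) : Subgroup (Matrix.unitaryGroup (Fin n ⊕ Fin n) ℂ) where
  carrier := {A | (A.1)ᵀ * J n * A.1 = J n}
  one_mem' := by simp
  mul_mem' := by
    intro a b ha hb
    simp only [Set.mem_ofPred_eq] at ha hb ⊢
    calc (a.1 * b.1)ᵀ * J n * (a.1 * b.1)
        = (b.1)ᵀ * ((a.1)ᵀ * J n * a.1) * b.1 := by
          rw [Matrix.transpose_mul]; simp only [Matrix.mul_assoc]
      _ = J n := by rw [ha, hb]
  inv_mem' := by
    intro a ha
    simp only [Set.mem_ofPred_eq] at ha ⊢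
    have h : a.1 * (a⁻¹).1 = 1 := congrArg Subtype.val (mul_inv_cancel a)
    have h' : ((a⁻¹).1)ᵀ * (a.1)ᵀ = 1 := by
      rw [← Matrix.transpose_mul, h, Matrix.transpose_one]
    calc ((a⁻¹).1)ᵀ * J n * (a⁻¹).1
        = ((a⁻¹).1)ᵀ * ((a.1)ᵀ * J n * a.1) * (a⁻¹).1 := by rw [ha]
      _ = (((a⁻¹).1)ᵀ * (a.1)ᵀ) * J n * (a.1 * (a⁻¹).1) := by
          simp only [Matrix.mul_assoc]
      _ = J n := by rw [h, h', Matrix.one_mul, Matrix.mul_one]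

/-- The underlying matrix of an element of `Sp(n)`. -/
def spMatrix {n : ℕ} (g : Sp n) : Matrix (Fin n ⊕ Fin n) (Fin n ⊕ Fin n) ℂ := g.1.1

/-- The density matrices on `ℂ^{2n}`: positive semidefinite (in particular Hermitian) matrices
of trace one, with the topology induced from the space of all matrices. -/
abbrev DensityMatrix (n : ℕ) : Type :=
  {ρ : Matrix (Fin n ⊕ Fin n) (Fin n ⊕ Fin n) ℂ // ρ.PosSemidef ∧ ρ.trace = 1}

/-- `Sp(n)` acts on the density matrices by conjugation, `g • ρ = g ρ g⁻¹`. -/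
instance (n : ℕ) : MulAction (Sp n) (DensityMatrix n) where
  smul g ρ := ⟨spMatrix g * ρ.1 * spMatrix g⁻¹, by
    have hstar : spMatrix g⁻¹ = (spMatrix g)ᴴ := rfl
    refine ⟨?_, ?_⟩
    · rw [hstar]
      exact ρ.2.1.mul_mul_conjTranspose_same (spMatrix g)
    · have h : spMatrix g⁻¹ * spMatrix g = 1 :=
        congrArg (fun a : Sp n => spMatrix a) (inv_mul_cancel g)
      rw [Matrix.mul_assoc, Matrix.trace_mul_comm, Matrix.mul_assoc, h, Matrix.mul_one]
      exact ρ.2.2⟩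
  one_smul ρ := by
    apply Subtype.ext
    change spMatrix (1 : Sp n) * ρ.1 * spMatrix ((1 : Sp n)⁻¹) = ρ.1
    rw [inv_one]
    change (1 : Matrix (Fin n ⊕ Fin n) (Fin n ⊕ Fin n) ℂ) * ρ.1 * 1 = ρ.1
    simp
  mul_smul g h ρ := by
    apply Subtype.ext
    change spMatrix (g * h) * ρ.1 * spMatrix ((g * h)⁻¹) =
      spMatrix g * (spMatrix h * ρ.1 * spMatrix h⁻¹) * spMatrix g⁻¹
    rw [mul_inv_rev]
    change (spMatrix g * spMatrix h) * ρ.1 * (spMatrix h⁻¹ * spMatrix g⁻¹) = _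
    simp only [Matrix.mul_assoc]

/-- The homomorphism `(z₁, …, zₙ) ↦ diag(z₁, …, zₙ, z̄₁, …, z̄ₙ)` from `U(1)ⁿ` to `Sp(n)`. -/
def torusHom (n : ℕ) : (Fin n → Circle) →* Sp n where
  toFun z := ⟨⟨Matrix.diagonal (Sum.elim (fun i => (z i : ℂ)) fun i => star (z i : ℂ)), by
      rw [Matrix.mem_unitaryGroup_iff, Matrix.star_eq_conjTranspose, Matrix.diagonal_conjTranspose,
        Matrix.diagonal_mul_diagonal, ← Matrix.diagonal_one]
      congr 1
      funext i
      rcases i with i | i <;> simp [Complex.mul_conj, ← Complex.normSq_eq_conj_mul_self]⟩, by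
      change (Matrix.diagonal _)ᵀ * J n * Matrix.diagonal _ = J n
      ext i j
      rw [Matrix.diagonal_transpose, Matrix.mul_diagonal, Matrix.diagonal_mul]
      rcases i with i | i <;> rcases j with j | j <;>
        by_cases hij : i = j <;>
        simp [J, hij, Complex.mul_conj, ← Complex.normSq_eq_conj_mul_self]⟩
  map_one' := by
    apply Subtype.ext
    apply Subtype.ext
    change Matrix.diagonal _ = 1
    rw [← Matrix.diagonal_one]
    congr 1
    funext i
    rcases i with i | i <;> simp
  map_mul' z w := by
    apply Subtype.ext
    apply Subtype.ext
    change Matrix.diagonal _ = Matrix.diagonal _ * Matrix.diagonal _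
    rw [Matrix.diagonal_mul_diagonal]
    congr 1
    funext i
    rcases i with i | i <;> simp

/-- The diagonal subgroup `Tⁿ = {diag(z₁, …, zₙ, z̄₁, …, z̄ₙ) : |zᵢ| = 1}` of `Sp(n)`. -/
def torus (n : ℕ) : Subgroup (Sp n) := (torusHom n).range

/-- A subgroup of a topological group is a torus if it is isomorphic, as a topological group,
to a finite power of the circle group. -/
def IsTorus {G : Type*} [Group G] [TopologicalSpace G] (T : Subgroup G) : Prop :=
  ∃ k : ℕ, Nonempty (T ≃ₜ* (Fin k → Circle))

/-- A maximal torus: a torus that is not properly contained in another torus. -/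
def IsMaximalTorus {G : Type*} [Group G] [TopologicalSpace G] (T : Subgroup G) : Prop :=
  Maximal IsTorus T

/-- The orbit `Sp(n) · ρ` is a homogeneous manifold of real dimension `d`.
That is: `Sp(n)`, with its topology as a group of matrices, is a smooth Lie group whose inclusion
into the real vector space of complex matrices (written as doubly indexed families) is a smooth
embedding, which determines its smooth structure; the orbit, with the subspace topology, is a
smooth `d`-manifold without boundary which is smoothly embedded in that vector space; `Sp(n)` acts
smoothly and transitively on it; and the
canonical bijection from the orbit to `Sp(n)` modulo the stabilizer of `ρ` is a homeomorphism. -/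
def OrbitIsHomogeneousManifold {n : ℕ} (ρ : DensityMatrix n) (d : ℕ) : Prop :=
  ∃ (k : ℕ) (_ : ChartedSpace (EuclideanSpace ℝ (Fin k)) (Sp n))
    (_ : ChartedSpace (EuclideanSpace ℝ (Fin d)) (MulAction.orbit (Sp n) ρ)),
    LieGroup (𝓡 k) ∞ (Sp n) ∧
    Manifold.IsSmoothEmbedding (𝓡 k) 𝓘(ℝ, Fin n ⊕ Fin n → Fin n ⊕ Fin n → ℂ) ∞
      (fun (g : Sp n) i j => spMatrix g i j) ∧
    IsManifold (𝓡 d) ∞ (MulAction.orbit (Sp n) ρ) ∧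
    Manifold.IsSmoothEmbedding (𝓡 d) 𝓘(ℝ, Fin n ⊕ Fin n → Fin n ⊕ Fin n → ℂ) ∞
      (fun (σ : MulAction.orbit (Sp n) ρ) i j => σ.1.1 i j) ∧
    ContMDiffSMul (𝓡 k) (𝓡 d) ∞ (Sp n) (MulAction.orbit (Sp n) ρ) ∧
    MulAction.IsPretransitive (Sp n) (MulAction.orbit (Sp n) ρ) ∧
    IsHomeomorph (MulAction.orbitEquivQuotientStabilizer (Sp n) ρ)

end SymplecticOrbit

end

/-! Torus part: conjugating by a torus element with a single nontrivial entry `I` forces every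
matrix commuting with `torus n` to be diagonal (`isDiag_of_commute_torus`), and a diagonal element
of `Sp n` already lies in `torus n`. The torus is thus its own centralizer, hence maximal, since any
larger torus is abelian. Diagonal matrices commute with a diagonal `ρ`, which gives the stabilizer
claim.

Manifold part: the Cayley transform serves as an algebraic substitute for the exponential. It is an
involution exchanging neighbourhoods of `0` and `1`, and it matches the linear space `lieSp n` with
the group (`isCayleyGroup_sp`), so it parametrizes `Sp n` near `1`. Split `lieSp n` as `𝔪 + 𝔨`,
where `𝔨` is the infinitesimal stabilizer of `ρ`. Near `1` every group element is `cay X * cay Y`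
with `X` in `𝔪` and `Y` in `𝔨`. The second factor fixes `ρ`, so conjugating `ρ` by `cay X`
parametrizes the orbit near `ρ` (`IsCayleyGroup.isParametrization_orbit`). Compactness of `Sp n`
ensures that the orbit map is open onto the orbit with its subspace topology. Translation carries
both parametrizations to all other points, and `exists_isSmoothEmbedding` turns them into embedded
manifold structures. Group operations and action are restrictions of smooth maps of matrices, hence
smooth.

Dimension: for diagonal `ρ` all diagonal elements of `lieSp n` lie in `𝔨`, so `𝔪` contains no
nonzero diagonal matrix. Off-diagonal parts are determined by `n ^ 2` complex entries, whence `2 * n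
^ 2`. -/

section

open Filter Topology Set

namespace EmbeddedSubmanifold

/-! ### Slice charts from immersive parametrizations -/

section Slice

variable {V E : Type*} [NormedAddCommGroup V] [NormedSpace ℝ V]
  [NormedAddCommGroup E] [NormedSpace ℝ E]

/-- `f` is a smooth immersive parametrization, near `0`, of the subset `S` near `f 0`, with
derivative `L` at `0`. -/
structure IsParametrization (f : V → E) (L : V →L[ℝ] E) (S : Set E) : Prop where
  contDiffAt : ∀ᶠ u in 𝓝 (0 : V), ContDiffAt ℝ ∞ f u
  hasFDerivAt : HasFDerivAt f L 0
  injective : Function.Injective L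
  map_nhds : map f (𝓝 0) = 𝓝[S] (f 0)

/-- A diffeomorphism between open subsets of `E` is a slice chart for `S`, adapted to `L`, if it
flattens `S` onto the range of `L`. -/
structure IsSliceChart (Φ : OpenPartialHomeomorph E E) (L : V →L[ℝ] E) (S : Set E) : Prop where
  contDiffOn : ContDiffOn ℝ ∞ Φ Φ.source
  contDiffOn_symm : ContDiffOn ℝ ∞ Φ.symm Φ.target
  mem_iff : ∀ x ∈ Φ.source, (x ∈ S ↔ Φ x ∈ range L)

/-- Used to replace the parameter space by a Euclidean space and to move a parametrization to other
points by a translation or conjugation. -/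
theorem IsParametrization.comp_equiv {V' E' : Type*} [NormedAddCommGroup V'] [NormedSpace ℝ V']
    [NormedAddCommGroup E'] [NormedSpace ℝ E']
    {f : V → E} {L : V →L[ℝ] E} {S : Set E} (h : IsParametrization f L S) (e : V' ≃L[ℝ] V)
    (T : E ≃L[ℝ] E') :
    IsParametrization (fun u => T (f (e u))) ((T : E →L[ℝ] E') ∘L L ∘L (e : V' →L[ℝ] V))
      (T '' S) where
  contDiffAt := by
    have : Tendsto e (𝓝 0) (𝓝 0) := by simpa using e.continuous.tendsto 0
    filter_upwards [this.eventually h.contDiffAt] with u hu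
    exact T.contDiff.contDiffAt.comp u (hu.comp u e.contDiff.contDiffAt)
  hasFDerivAt := by
    have h1 : HasFDerivAt f L (e 0) := by simpa using h.hasFDerivAt
    exact T.hasFDerivAt.comp (0 : V') (h1.comp (0 : V') e.hasFDerivAt)
  injective := T.injective.comp (h.injective.comp e.injective)
  map_nhds := by
    have h1 : map e (𝓝 0) = 𝓝 0 := by
      simpa using e.toHomeomorph.map_nhds_eq 0
    have h2 : map T (𝓝[S] (f 0)) = 𝓝[T '' S] (T (f 0)) :=
      T.toHomeomorph.isEmbedding.map_nhdsWithin_eq S (f 0)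
    rw [show (fun u => T (f (e u))) = T ∘ f ∘ e from rfl, ← map_map, ← map_map, h1, h.map_nhds, h2]
    simp

/-- Thicken `f` along the complement `ker π` of `range L` to a map `Ψ` of `E` with derivative the
identity at `0`. The inverse function theorem makes it a local diffeomorphism, whose inverse is the
chart. -/
theorem IsParametrization.exists_sliceChart [CompleteSpace E] {f : V → E} {L : V →L[ℝ] E}
    {S : Set E} (h : IsParametrization f L S) (π : E →L[ℝ] V) (hπ : ∀ u, π (L u) = u) :
    ∃ Φ : OpenPartialHomeomorph E E, f 0 ∈ Φ.source ∧ IsSliceChart Φ L S := by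
  set Ψ : E → E := fun w => f (π w) + (w - L (π w)) with hΨ
  have hΨL : ∀ u, Ψ (L u) = f u := fun u => by simp [hΨ, hπ]
  have hΨ0 : Ψ 0 = f 0 := by simp [hΨ]
  have hπ0 : Tendsto π (𝓝 0) (𝓝 0) := by simpa using π.continuous.tendsto 0
  have hsmooth : ∀ᶠ w in 𝓝 (0 : E), ContDiffAt ℝ ∞ Ψ w := by
    filter_upwards [hπ0.eventually h.contDiffAt] with w hw
    exact (hw.comp w π.contDiff.contDiffAt).add
      (contDiffAt_id.sub (L.contDiff.comp π.contDiff).contDiffAt)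
  have hd : HasFDerivAt Ψ ((ContinuousLinearEquiv.refl ℝ E : E ≃L[ℝ] E) : E →L[ℝ] E) 0 := by
    have h1 : HasFDerivAt f L (π 0) := by simpa using h.hasFDerivAt
    have h2 := (h1.comp (0 : E) π.hasFDerivAt).add
      ((hasFDerivAt_id (𝕜 := ℝ) (0 : E)).sub (L.hasFDerivAt.comp (0 : E) π.hasFDerivAt))
    convert! h2 using 1
    ext w
    simp
  have hsm0 : ContDiffAt ℝ ∞ Ψ 0 := hsmooth.self_of_nhds
  set R := hsm0.toOpenPartialHomeomorph Ψ hd (by simp) with hR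
  have hRcoe : (R : E → E) = Ψ := rfl
  have hR0 : (0 : E) ∈ R.source := hsm0.mem_toOpenPartialHomeomorph_source hd (by simp)
  -- Smoothness of the inverse on a whole neighbourhood needs an invertible derivative at each
  -- point, not only at `0`; invertible operators form an open set.
  have hinv : ∀ᶠ w in 𝓝 (0 : E), ∃ e : E ≃L[ℝ] E, HasFDerivAt Ψ (e : E →L[ℝ] E) w := by
    have hc : ContinuousAt (fderiv ℝ Ψ) 0 :=
      (hsm0.fderiv_right (m := 0) (by simp)).continuousAt
    have h1 : ∀ᶠ w in 𝓝 (0 : E),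
        fderiv ℝ Ψ w ∈ range ((↑) : (E ≃L[ℝ] E) → (E →L[ℝ] E)) := by
      apply hc
      rw [hd.fderiv]
      exact ContinuousLinearEquiv.nhds _
    filter_upwards [h1, hsmooth] with w ⟨e, he⟩ hw
    exact ⟨e, he ▸ (hw.differentiableAt (by simp)).hasFDerivAt⟩
  have hS : ∀ᶠ w in 𝓝 (0 : E), f (π w) ∈ S := by
    have h1 : ∀ᶠ x in map f (𝓝 0), x ∈ S := by
      rw [h.map_nhds]; exact self_mem_nhdsWithin
    exact hπ0.eventually h1
  -- Equality in `map_nhds` excludes other branches of `S` near `f 0`: nearby points of `S` are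
  -- values of `f` at small parameters.
  have hS' : ∀ᶠ w in 𝓝 (0 : E), Ψ w ∈ S → ∃ u, L u ∈ R.source ∧ f u = Ψ w := by
    have hU : {u | L u ∈ R.source} ∈ 𝓝 (0 : V) :=
      (R.open_source.preimage L.continuous).mem_nhds (by simpa using hR0)
    have h1 : f '' {u | L u ∈ R.source} ∈ 𝓝[S] (f 0) := h.map_nhds ▸ image_mem_map hU
    rw [mem_nhdsWithin_iff_eventually, ← hΨ0] at h1
    exact hsm0.continuousAt.eventually h1
  obtain ⟨W, hW, hWo, hW0⟩ := eventually_nhds_iff.1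
    (hsmooth.and (hinv.and (hS.and hS')))
  refine ⟨(R.restrOpen W hWo).symm, ?_, ?_, ?_, ?_⟩
  · have h0 : (0 : E) ∈ (R.restrOpen W hWo).source := by simp [hR0, hW0]
    have := (R.restrOpen W hWo).map_source h0
    simpa [hRcoe, hΨ0] using this
  · intro x hx
    have hx' := (R.restrOpen W hWo).map_target hx
    have hxW : (R.restrOpen W hWo).symm x ∈ W := by
      simp only [OpenPartialHomeomorph.restrOpen_source] at hx'; exact hx'.2
    obtain ⟨e, he⟩ := (hW _ hxW).2.1
    exact ((R.restrOpen W hWo).contDiffAt_symm hx he (hW _ hxW).1).contDiffWithinAt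
  · intro w hw
    have hw' : w ∈ R.source ∩ W := by simpa using hw
    exact (hW _ hw'.2).1.contDiffWithinAt
  · intro x hx
    have hx' := (R.restrOpen W hWo).map_target hx
    have hxr : Ψ ((R.restrOpen W hWo).symm x) = x := (R.restrOpen W hWo).right_inv hx
    set w := (R.restrOpen W hWo).symm x with hw
    rw [OpenPartialHomeomorph.restrOpen_source] at hx'
    obtain ⟨-, -, h3, h4⟩ := hW _ hx'.2
    constructor
    · intro hxS
      rw [← hxr] at hxS
      obtain ⟨u, hu, hfu⟩ := h4 hxS
      refine ⟨u, R.injOn hu hx'.1 ?_⟩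
      rw [hRcoe, hΨL, hfu]
    · rintro ⟨u, hu⟩
      change L u = w at hu
      rw [← hxr, ← hu, hΨL]
      simpa [← hu, hπ] using h3

end Slice

/-! ### The manifold structure of an embedded subset -/

section Charts

variable {V E M : Type*} [NormedAddCommGroup V] [NormedSpace ℝ V]
  [NormedAddCommGroup E] [NormedSpace ℝ E] [TopologicalSpace M]

/-- The chart of an embedded subset induced by a slice chart of the ambient space. -/
noncomputable def inducedChart [Nonempty M] {ι : M → E} (hι : IsEmbedding ι)
    {Φ : OpenPartialHomeomorph E E} {L : V →L[ℝ] E} (hΦ : IsSliceChart Φ L (range ι))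
    (π : E →L[ℝ] V) (hπ : ∀ u, π (L u) = u) : OpenPartialHomeomorph M V :=
  have hL : ∀ q, ι q ∈ Φ.source → L (π (Φ (ι q))) = Φ (ι q) := fun q hq => by
    obtain ⟨u, hu⟩ := (hΦ.mem_iff _ hq).1 ⟨q, rfl⟩
    rw [← hu, hπ]
  have hinv : ∀ u, L u ∈ Φ.target →
      ι (Function.invFun ι (Φ.symm (L u))) = Φ.symm (L u) := fun u hu =>
    Function.invFun_eq (f := ι) <| (hΦ.mem_iff _ (Φ.map_target hu)).2 ⟨u, (Φ.right_inv hu).symm⟩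
  { toFun := fun q => π (Φ (ι q))
    invFun := fun u => Function.invFun ι (Φ.symm (L u))
    source := ι ⁻¹' Φ.source
    target := L ⁻¹' Φ.target
    map_source' := fun q hq => by
      simp only [mem_preimage]
      rw [hL q hq]
      exact Φ.map_source hq
    map_target' := fun u hu => by
      simp only [mem_preimage]
      rw [hinv u hu]
      exact Φ.map_target hu
    left_inv' := fun q hq => by
      rw [hL q hq, Φ.left_inv hq]
      exact Function.leftInverse_invFun hι.injective q
    right_inv' := fun u hu => by
      rw [hinv u hu, Φ.right_inv hu, hπ]
    open_source := Φ.open_source.preimage hι.continuous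
    open_target := Φ.open_target.preimage L.continuous
    continuousOn_toFun := π.continuous.comp_continuousOn
      (Φ.continuousOn.comp hι.continuous.continuousOn fun _ hq => hq)
    continuousOn_invFun := by
      rw [hι.isInducing.continuousOn_iff]
      refine (Φ.continuousOn_symm.comp L.continuous.continuousOn fun _ hu => hu).congr ?_
      exact fun u hu => hinv u hu }

theorem apply_inducedChart_symm [Nonempty M] {ι : M → E} (hι : IsEmbedding ι)
    {Φ : OpenPartialHomeomorph E E} {L : V →L[ℝ] E} (hΦ : IsSliceChart Φ L (range ι))
    (π : E →L[ℝ] V) (hπ : ∀ u, π (L u) = u) {u : V} (hu : L u ∈ Φ.target) :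
    ι ((inducedChart hι hΦ π hπ).symm u) = Φ.symm (L u) :=
  Function.invFun_eq (f := ι) <| (hΦ.mem_iff _ (Φ.map_target hu)).2 ⟨u, (Φ.right_inv hu).symm⟩

end Charts

/-- An embedded subset of a finite-dimensional vector space which has a smooth immersive
parametrization around each of its points is a smoothly embedded manifold. -/
theorem exists_isSmoothEmbedding {V E M : Type*} [NormedAddCommGroup V] [NormedSpace ℝ V]
    [FiniteDimensional ℝ V] [NormedAddCommGroup E] [NormedSpace ℝ E] [FiniteDimensional ℝ E]
    [TopologicalSpace M] {ι : M → E} (hι : IsEmbedding ι)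
    (h : ∀ p, ∃ (f : V → E) (L : V →L[ℝ] E), f 0 = ι p ∧ IsParametrization f L (range ι)) :
    ∃ _ : ChartedSpace V M, IsManifold 𝓘(ℝ, V) ∞ M ∧
      Manifold.IsSmoothEmbedding 𝓘(ℝ, V) 𝓘(ℝ, E) ∞ ι := by
  have : CompleteSpace E := FiniteDimensional.complete ℝ E
  choose f L hf hp using h
  have hex : ∀ p, ∃ π : E →L[ℝ] V, ∀ u, π (L p u) = u := fun p => by
    obtain ⟨g, hg⟩ := (L p : V →ₗ[ℝ] E).exists_leftInverse_of_injective
      (LinearMap.ker_eq_bot.2 (hp p).injective)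
    exact ⟨LinearMap.toContinuousLinearMap g, fun u => LinearMap.congr_fun hg u⟩
  choose π hπ using hex
  choose Φ hΦ0 hΦ using fun p => (hp p).exists_sliceChart (π p) (hπ p)
  let c : M → OpenPartialHomeomorph M V := fun p =>
    haveI : Nonempty M := ⟨p⟩
    inducedChart hι (hΦ p) (π p) (hπ p)
  have hc0 : ∀ p, p ∈ (c p).source := fun p => by
    change ι p ∈ (Φ p).source
    rw [← hf p]; exact hΦ0 p
  have hcsymm : ∀ p u, L p u ∈ (Φ p).target → ι ((c p).symm u) = (Φ p).symm (L p u) :=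
    fun p u hu =>
      haveI : Nonempty M := ⟨p⟩
      apply_inducedChart_symm hι (hΦ p) (π p) (hπ p) hu
  let C : ChartedSpace V M :=
    { atlas := range c
      chartAt := c
      mem_chart_source := hc0
      chart_mem_atlas := fun p => ⟨p, rfl⟩ }
  have hM : IsManifold 𝓘(ℝ, V) ∞ M := by
    apply isManifold_of_contDiffOn
    rintro _ _ ⟨p, rfl⟩ ⟨q, rfl⟩
    -- Transition maps factor through the ambient slice charts, so no `Function.invFun` survives in
    -- them.
    have h1 : ContDiffOn ℝ ∞ (fun u => π q (Φ q ((Φ p).symm (L p u))))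
        ((c p).symm ≫ₕ c q).source := by
      refine (π q).contDiff.comp_contDiffOn ((hΦ q).contDiffOn.comp
        ((hΦ p).contDiffOn_symm.comp (L p).contDiff.contDiffOn ?_) ?_)
      · intro u hu
        exact hu.1
      · intro u hu
        have h2 : ι ((c p).symm u) ∈ (Φ q).source := hu.2
        rwa [hcsymm p u hu.1] at h2
    refine (h1.congr ?_).mono ?_
    · intro u hu
      change π q (Φ q (ι ((c p).symm u))) = _
      rw [hcsymm p u hu.1]
    · intro u hu
      exact hu.1
  refine ⟨C, hM, ?_, hι⟩
  let F := EuclideanSpace ℝ (Fin (Module.finrank ℝ E - Module.finrank ℝ V))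
  refine Manifold.IsImmersionOfComplement.isImmersion (F := F) fun p => ?_
  -- The immersion normal form needs a model complement: `F` has the dimension of `ker (π p)`, and
  -- `E` is the direct sum of `range (L p)` and that kernel.
  have he : ∃ e : (V × F) ≃L[ℝ] E, ∀ u, e (u, 0) = L p u := by
    let K := LinearMap.ker (π p : E →ₗ[ℝ] V)
    have hsurj : Function.Surjective (π p : E →ₗ[ℝ] V) := fun u => ⟨L p u, hπ p u⟩
    have hK : Module.finrank ℝ K = Module.finrank ℝ E - Module.finrank ℝ V := by
      have h1 := LinearMap.finrank_range_add_finrank_ker (π p : E →ₗ[ℝ] V)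
      rw [LinearMap.range_eq_top.2 hsurj, finrank_top] at h1
      change Module.finrank ℝ V + Module.finrank ℝ K = _ at h1
      omega
    let g : F ≃ₗ[ℝ] K := LinearEquiv.ofFinrankEq _ _ (by rw [hK, finrank_euclideanSpace_fin])
    let l : (V × F) →ₗ[ℝ] E :=
      (L p : V →ₗ[ℝ] E).coprod (K.subtype ∘ₗ (g : F →ₗ[ℝ] K))
    have hl : Function.Bijective l := by
      constructor
      · rw [injective_iff_map_eq_zero]
        rintro ⟨u, v⟩ huv
        have huv' : L p u + (g v : E) = 0 := huv
        have h2 : π p (g v : E) = 0 := (g v).2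
        have hu : u = 0 := by
          have := congrArg (π p) huv'
          simpa [hπ, h2] using this
        have hv : g v = 0 := by
          apply Subtype.ext
          simpa [hu] using huv'
        simp [hu, g.map_eq_zero_iff.1 hv]
      · intro x
        have hx : x - L p (π p x) ∈ K := by
          change π p (x - L p (π p x)) = 0
          simp [hπ]
        refine ⟨(π p x, g.symm ⟨_, hx⟩), ?_⟩
        change L p (π p x) + (g (g.symm ⟨_, hx⟩) : E) = x
        simp
    refine ⟨(LinearEquiv.ofBijective l hl).toContinuousLinearEquiv, fun u => ?_⟩
    change L p u + (g 0 : E) = L p u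
    simp
  obtain ⟨e, he⟩ := he
  refine .mk_of_charts e (chartAt V p) (Φ p) (hc0 p) (hc0 p)
    (IsManifold.chart_mem_maximalAtlas p) ?_ subset_rfl ?_
  · exact OpenPartialHomeomorph.mem_maximalAtlas_of_contMDiffOn (Φ p)
      (hΦ p).contDiffOn.contMDiffOn (hΦ p).contDiffOn_symm.contMDiffOn
  · intro u hu
    have hu' : L p u ∈ (Φ p).target := by
      have h2 : u ∈ (chartAt V p).target := by simpa using hu
      exact h2
    have h3 : Φ p (ι ((c p).symm u)) = e (u, 0) := by
      rw [hcsymm p u hu', (Φ p).right_inv hu', he]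
    simp only [OpenPartialHomeomorph.extend_coe, OpenPartialHomeomorph.extend_coe_symm,
      Function.comp_apply]
    exact h3

end EmbeddedSubmanifold

end

/-! ### The Cayley transform -/

section

open Filter Topology Set EmbeddedSubmanifold

namespace Cayley

section Algebra

variable {A : Type*} [Ring A]

/-- The Cayley transform `X ↦ (1 - X) (1 + X)⁻¹`, written as `2 (1 + X)⁻¹ - 1`. -/
noncomputable def cay (X : A) : A := 2 * Ring.inverse (1 + X) - 1

theorem cay_zero : cay (0 : A) = 1 := by
  simp only [cay, add_zero, Ring.inverse_one]; norm_num

theorem cay_cay (h2 : IsUnit (2 : A)) {X : A} (hX : IsUnit (1 + X)) : cay (cay X) = X := by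
  have : 1 + cay X = 2 * Ring.inverse (1 + X) := by simp [cay]
  rw [cay, this]
  have h3 : Ring.inverse (2 * Ring.inverse (1 + X)) = (1 + X) * Ring.inverse 2 := by
    rw [Ring.inverse_mul (Or.inl h2)]
    congr 1
    obtain ⟨u, hu⟩ := hX
    rw [← hu, Ring.inverse_unit, Ring.inverse_unit, inv_inv]
  have h4 : 2 * ((1 + X) * Ring.inverse 2) = 1 + X := by
    rw [← mul_assoc, two_mul, ← mul_two, mul_assoc, Ring.mul_inverse_cancel _ h2, mul_one]
  rw [h3, h4]
  simp

theorem cay_mul_cay_neg {X : A} (hX : IsUnit (1 + X)) (hX' : IsUnit (1 - X)) :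
    cay X * cay (-X) = 1 := by
  rw [cay, cay, ← sub_eq_add_neg]
  set v := Ring.inverse (1 + X)
  set w := Ring.inverse (1 - X)
  have hv : v * (1 + X) = 1 := Ring.inverse_mul_cancel _ hX
  have hw : (1 - X) * w = 1 := Ring.mul_inverse_cancel _ hX'
  have h : 2 * (v * w) = v + w := by
    calc 2 * (v * w) = v * ((1 - X) + (1 + X)) * w := by noncomm_ring
      _ = v * ((1 - X) * w) + (v * (1 + X)) * w := by noncomm_ring
      _ = v + w := by rw [hv, hw, mul_one, one_mul]
  have h' : (2 * v - 1) * (2 * w - 1) = 2 * (2 * (v * w) - (v + w)) + 1 := by noncomm_ring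
  rw [h', h]
  simp

theorem cay_neg_mul_cay {X : A} (hX : IsUnit (1 + X)) (hX' : IsUnit (1 - X)) :
    cay (-X) * cay X = 1 := by
  have := cay_mul_cay_neg (X := -X) (by rwa [← sub_eq_add_neg]) (by rwa [sub_neg_eq_add])
  rwa [neg_neg] at this

theorem inverse_cay {X : A} (hX : IsUnit (1 + X)) (hX' : IsUnit (1 - X)) :
    Ring.inverse (cay X) = cay (-X) :=
  Ring.inverse_unit ⟨cay X, cay (-X), cay_mul_cay_neg hX hX', cay_neg_mul_cay hX hX'⟩

theorem cay_eq_neg_of_mul_eq_one {a b : A} (hab : b * a = 1) (ha : IsUnit (1 + a))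
    (hb : IsUnit (1 + b)) : cay b = -cay a := by
  rw [cay, cay]
  set v := Ring.inverse (1 + a)
  set w := Ring.inverse (1 + b)
  have hv : (1 + a) * v = 1 := Ring.mul_inverse_cancel _ ha
  have hw : w * (1 + b) = 1 := Ring.inverse_mul_cancel _ hb
  have h : w = a * v := by
    calc w = w * ((1 + a) * v) := by rw [hv, mul_one]
      _ = w * ((b * a + a) * v) := by rw [hab]
      _ = (w * (1 + b)) * (a * v) := by noncomm_ring
      _ = a * v := by rw [hw, one_mul]
  have h' : 2 * (a * v) - 1 = 2 * ((1 + a) * v) - 2 * v - 1 := by noncomm_ring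
  rw [h, h', hv]
  noncomm_ring

/-- Intertwining passes to the inverses of `1 + a` and `1 + b`. Serves both for `c = J n` and for
elements commuting with `ρ`. -/
theorem cay_mul_eq_mul_cay {a b c : A} (ha : IsUnit (1 + a)) (hb : IsUnit (1 + b))
    (h : a * c = c * b) : cay a * c = c * cay b := by
  rw [cay, cay]
  set v := Ring.inverse (1 + a)
  set w := Ring.inverse (1 + b)
  have hv : v * (1 + a) = 1 := Ring.inverse_mul_cancel _ ha
  have hw : (1 + b) * w = 1 := Ring.mul_inverse_cancel _ hb
  have h' : v * c = c * w := by
    calc v * c = v * (c * ((1 + b) * w)) := by rw [hw, mul_one]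
      _ = v * ((c + c * b) * w) := by noncomm_ring
      _ = (v * (1 + a)) * (c * w) := by rw [← h]; noncomm_ring
      _ = c * w := by rw [hv, one_mul]
  calc (2 * v - 1) * c = 2 * (v * c) - c := by noncomm_ring
    _ = 2 * (c * w) - c := by rw [h']
    _ = c * (2 * w - 1) := by noncomm_ring

end Algebra

theorem eventually_isUnit {A T : Type*} [NormedRing A] [CompleteSpace A] [TopologicalSpace T] {g : T → A} {t : T}
    (hg : ContinuousAt g t) (h : IsUnit (g t)) : ∀ᶠ s in 𝓝 t, IsUnit (g s) :=
  hg.eventually (Units.isOpen.mem_nhds h)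

variable {A : Type*} [NormedRing A] [NormedAlgebra ℝ A]

theorem isUnit_two : IsUnit (2 : A) := by
  have := (IsUnit.mk0 (2 : ℝ) two_ne_zero).map (algebraMap ℝ A)
  rwa [map_ofNat] at this

theorem cay_one : cay (1 : A) = 0 := by
  have h := cay_cay (isUnit_two (A := A)) (X := 0) (by simp)
  rwa [cay_zero] at h

variable [CompleteSpace A]

/-- When `1 + X` is scalar, the two inverse factors in the derivative of inversion commute past the
increment. Only `X = 0` and `X = 1` are needed. -/
theorem hasFDerivAt_cay {X : A} {c : ℝ} (hc : c ≠ 0) (hX : 1 + X = algebraMap ℝ A c) :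
    HasFDerivAt cay (-(2 * c⁻¹ ^ 2) • ContinuousLinearMap.id ℝ A) X := by
  let u : Aˣ := Units.map (algebraMap ℝ A : ℝ →* A) (Units.mk0 c hc)
  have hu : (u : A) = 1 + X := hX.symm
  have hui : ((u⁻¹ : Aˣ) : A) = algebraMap ℝ A c⁻¹ := rfl
  have h1 : HasFDerivAt (fun Y : A => 1 + Y) (ContinuousLinearMap.id ℝ A) X :=
    (hasFDerivAt_id X).const_add 1
  have h2 : HasFDerivAt Ring.inverse _ (1 + X) := hu ▸ hasFDerivAt_ringInverse (𝕜 := ℝ) u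
  have h3 := ((h2.comp X h1).const_mul (2 : A)).sub_const 1
  convert! h3 using 1
  ext Y
  simp only [smul_apply, ContinuousLinearMap.id_apply,
    ContinuousLinearMap.comp_apply, neg_apply,
    ContinuousLinearMap.mulLeftRight_apply, hui, smul_eq_mul]
  rw [← Algebra.commutes, ← mul_assoc, ← map_mul, ← Algebra.smul_def, neg_smul, mul_neg,
    two_mul (_ • Y), ← two_smul ℝ, smul_smul, pow_two]

theorem contDiffAt_cay {X : A} (hX : IsUnit (1 + X)) : ContDiffAt ℝ ∞ cay X := by
  obtain ⟨u, hu⟩ := hX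
  have h : ContDiffAt ℝ ∞ Ring.inverse (1 + X) := hu ▸ contDiffAt_ringInverse ℝ u
  exact (contDiffAt_const.mul (h.comp X (contDiffAt_const.add contDiffAt_id))).sub contDiffAt_const

theorem hasStrictFDerivAt_cay {X : A} {c : ℝ} (hc : c ≠ 0) (hX : 1 + X = algebraMap ℝ A c) :
    HasStrictFDerivAt cay (-(2 * c⁻¹ ^ 2) • ContinuousLinearMap.id ℝ A) X :=
  (contDiffAt_cay (by rw [hX]; exact (IsUnit.mk0 c hc).map (algebraMap ℝ A))).hasStrictFDerivAt'
    (hasFDerivAt_cay hc hX) (by simp)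

theorem hasStrictFDerivAt_cay_zero :
    HasStrictFDerivAt cay (-(2 : ℝ) • ContinuousLinearMap.id ℝ A) 0 := by
  simpa using hasStrictFDerivAt_cay (A := A) (X := 0) one_ne_zero (by simp)

theorem hasStrictFDerivAt_cay_one :
    HasStrictFDerivAt cay (-(2⁻¹ : ℝ) • ContinuousLinearMap.id ℝ A) 1 := by
  convert! hasStrictFDerivAt_cay (A := A) (X := 1) two_ne_zero (by rw [map_ofNat, one_add_one_eq_two]) using 2
  norm_num

theorem tendsto_cay_zero : Tendsto cay (𝓝 (0 : A)) (𝓝 1) := by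
  simpa [ContinuousAt, cay_zero] using (contDiffAt_cay (X := (0 : A)) (by simp)).continuousAt

theorem tendsto_cay_one : Tendsto cay (𝓝 (1 : A)) (𝓝 0) := by
  simpa [ContinuousAt, cay_one] using
    (contDiffAt_cay (X := (1 : A)) (by rw [one_add_one_eq_two]; exact isUnit_two)).continuousAt

/-- `S` is a multiplicative set which the Cayley transform identifies, where it is defined, with
the linear subspace `𝔤`. -/
structure IsCayleyGroup (𝔤 : Submodule ℝ A) (S : Set A) : Prop where
  cay_mem : ∀ X ∈ 𝔤, IsUnit (1 + X) → cay X ∈ S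
  cay_mem' : ∀ a ∈ S, IsUnit (1 + a) → cay a ∈ 𝔤
  mul_mem : ∀ a ∈ S, ∀ b ∈ S, a * b ∈ S

variable {𝔤 : Submodule ℝ A} {S : Set A}

theorem eventually_isUnit_one_add (𝔪 : Submodule ℝ A) :
    ∀ᶠ X : 𝔪 in 𝓝 0, IsUnit (1 + (X : A)) ∧ IsUnit (1 - (X : A)) :=
  (eventually_isUnit (by fun_prop) (by simp)).and (eventually_isUnit (by fun_prop) (by simp))

theorem hasFDerivAt_cay_subtype (𝔪 : Submodule ℝ A) :
    HasFDerivAt (fun X : 𝔪 => cay (X : A)) (-(2 : ℝ) • 𝔪.subtypeL) 0 := by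
  have h : HasFDerivAt cay (-(2 : ℝ) • ContinuousLinearMap.id ℝ A) (𝔪.subtypeL 0) := by
    simpa using (hasStrictFDerivAt_cay_zero (A := A)).hasFDerivAt
  exact h.comp (0 : 𝔪) 𝔪.subtypeL.hasFDerivAt

theorem IsCayleyGroup.map_cay (h : IsCayleyGroup 𝔤 S) :
    map (fun X : 𝔤 => cay (X : A)) (𝓝 0) = 𝓝[S] 1 := by
  apply le_antisymm
  · refine tendsto_nhdsWithin_iff.2 ⟨?_, ?_⟩
    · exact tendsto_cay_zero.comp (by simpa using continuous_subtype_val.tendsto (0 : 𝔤))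
    · filter_upwards [eventually_isUnit_one_add 𝔤] with X hX
      exact h.cay_mem X X.2 hX.1
  · intro U hU
    rw [mem_map, nhds_subtype_eq_comap, mem_comap] at hU
    obtain ⟨W, hW, hWU⟩ := hU
    have h1 : ∀ᶠ a in 𝓝 (1 : A), cay a ∈ W := tendsto_cay_one.eventually (by simpa using hW)
    have h2 : ∀ᶠ a in 𝓝 (1 : A), IsUnit (1 + a) :=
      eventually_isUnit (by fun_prop) (by rw [one_add_one_eq_two]; exact isUnit_two)
    refine mem_nhdsWithin_iff_eventually.2 ?_
    filter_upwards [h1, h2] with a ha hu haS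
    have h3 := @hWU ⟨cay a, h.cay_mem' a haS hu⟩ ha
    simpa [cay_cay isUnit_two hu] using h3

theorem IsCayleyGroup.isParametrization (h : IsCayleyGroup 𝔤 S) :
    IsParametrization (fun X : 𝔤 => cay (X : A)) (-(2 : ℝ) • 𝔤.subtypeL) S where
  contDiffAt := by
    filter_upwards [eventually_isUnit_one_add 𝔤] with X hX
    exact (contDiffAt_cay hX.1).comp X 𝔤.subtypeL.contDiff.contDiffAt
  hasFDerivAt := hasFDerivAt_cay_subtype 𝔤
  injective := fun X Y hXY => by
    have : -(2 : ℝ) • (X : A) = -(2 : ℝ) • (Y : A) := hXY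
    exact Subtype.ext (smul_right_injective A (by norm_num : -(2 : ℝ) ≠ 0) this)
  map_nhds := by simpa [cay_zero] using h.map_cay

/-- Read in the Cayley coordinate, the product has derivative `(Y, Z) ↦ Y + Z`, which is onto `𝔤`; a
map with surjective strict derivative is locally open. -/
theorem IsCayleyGroup.map_cay_mul_cay [FiniteDimensional ℝ A] (h : IsCayleyGroup 𝔤 S)
    {𝔪 𝔨 : Submodule ℝ A} (hmk : 𝔪 ⊔ 𝔨 = 𝔤) :
    map (fun p : 𝔪 × 𝔨 => cay (p.1 : A) * cay (p.2 : A)) (𝓝 0) = 𝓝[S] 1 := by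
  have hm : 𝔪 ≤ 𝔤 := hmk ▸ le_sup_left
  have hk : 𝔨 ≤ 𝔤 := hmk ▸ le_sup_right
  obtain ⟨P', hP'⟩ := 𝔤.subtype.exists_leftInverse_of_injective 𝔤.ker_subtype
  let P : A →L[ℝ] 𝔤 := LinearMap.toContinuousLinearMap P'
  have hP : ∀ X : 𝔤, P X = X := fun X => LinearMap.congr_fun hP' X
  let a : 𝔪 × 𝔨 → A := fun p => cay (p.1 : A) * cay (p.2 : A)
  -- The projection `P` only makes `q` take values in `𝔤` everywhere; near `0` the element `cay (a
  -- p)` already lies there.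
  let q : 𝔪 × 𝔨 → 𝔤 := fun p => P (cay (a p))
  let D : (𝔪 × 𝔨) →L[ℝ] A := 𝔪.subtypeL ∘L ContinuousLinearMap.fst ℝ 𝔪 𝔨 +
    𝔨.subtypeL ∘L ContinuousLinearMap.snd ℝ 𝔪 𝔨
  have ha0 : a 0 = 1 := by simp [a, cay_zero]
  have hq0 : q 0 = 0 := by simp [q, ha0, cay_one]
  have hda : HasStrictFDerivAt a (-(2 : ℝ) • D) 0 := by
    have h1 : HasStrictFDerivAt (fun p : 𝔪 × 𝔨 => cay (p.1 : A)) _ 0 :=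
      HasStrictFDerivAt.comp (0 : 𝔪 × 𝔨) (hasStrictFDerivAt_cay_zero (A := A))
      (𝔪.subtypeL ∘L ContinuousLinearMap.fst ℝ 𝔪 𝔨).hasStrictFDerivAt
    have h2 : HasStrictFDerivAt (fun p : 𝔪 × 𝔨 => cay (p.2 : A)) _ 0 :=
      HasStrictFDerivAt.comp (0 : 𝔪 × 𝔨) (hasStrictFDerivAt_cay_zero (A := A))
      (𝔨.subtypeL ∘L ContinuousLinearMap.snd ℝ 𝔪 𝔨).hasStrictFDerivAt
    convert! h1.mul' h2 using 1
    ext p <;> simp [D, cay_zero]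
  have hdq : HasStrictFDerivAt q (P ∘L D) 0 := by
    have h1 : HasStrictFDerivAt cay (-(2⁻¹ : ℝ) • ContinuousLinearMap.id ℝ A) (a 0) := by
      rw [ha0]; exact hasStrictFDerivAt_cay_one
    have h2 : HasStrictFDerivAt q _ 0 := P.hasStrictFDerivAt.comp (0 : 𝔪 × 𝔨) (h1.comp _ hda)
    convert! h2 using 1
    ext p <;> simp [smul_smul]
  have hsurj : (P ∘L D).range = ⊤ := by
    refine LinearMap.range_eq_top.2 fun X => ?_
    obtain ⟨Y, hY, Z, hZ, hYZ⟩ := Submodule.mem_sup.1 (hmk ▸ X.2 : (X : A) ∈ 𝔪 ⊔ 𝔨)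
    refine ⟨(⟨Y, hY⟩, ⟨Z, hZ⟩), ?_⟩
    change P (Y + Z) = X
    rw [hYZ, hP]
  have hmq : map q (𝓝 0) = 𝓝 0 := by
    have := hdq.map_nhds_eq_of_surj hsurj
    rwa [hq0] at this
  have hev : (fun p => cay (q p : A)) =ᶠ[𝓝 0] a := by
    have e1 : ∀ᶠ p : 𝔪 × 𝔨 in 𝓝 0, IsUnit (1 + (p.1 : A)) :=
      eventually_isUnit (by fun_prop) (by simp)
    have e2 : ∀ᶠ p : 𝔪 × 𝔨 in 𝓝 0, IsUnit (1 + (p.2 : A)) :=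
      eventually_isUnit (by fun_prop) (by simp)
    have e3 : ∀ᶠ p : 𝔪 × 𝔨 in 𝓝 0, IsUnit (1 + a p) :=
      eventually_isUnit (continuousAt_const.add hda.continuousAt)
        (by rw [ha0, one_add_one_eq_two]; exact isUnit_two)
    filter_upwards [e1, e2, e3] with p h1 h2 h3
    have haS : a p ∈ S := h.mul_mem _ (h.cay_mem _ (hm p.1.2) h1) _ (h.cay_mem _ (hk p.2.2) h2)
    have h4 : (q p : A) = cay (a p) :=
      congrArg Subtype.val (hP ⟨cay (a p), h.cay_mem' _ haS h3⟩)
    rw [h4, cay_cay isUnit_two h3]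
  calc map a (𝓝 0) = map ((fun X : 𝔤 => cay (X : A)) ∘ q) (𝓝 0) := (map_congr hev).symm
    _ = 𝓝[S] 1 := by rw [← map_map, hmq, h.map_cay]

/-- The orbit of `ρ` under conjugation is parametrized, by means of the Cayley transform, by a
complement of the infinitesimal stabilizer. -/
theorem IsCayleyGroup.isParametrization_orbit [FiniteDimensional ℝ A] (h : IsCayleyGroup 𝔤 S)
    {𝔪 𝔨 : Submodule ℝ A} (hmk : 𝔪 ⊔ 𝔨 = 𝔤) {ρ : A} (hk : ∀ X ∈ 𝔨, X * ρ = ρ * X)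
    (hm : ∀ X ∈ 𝔪, X * ρ = ρ * X → X = 0) {O : Set A}
    (hO : map (fun a => a * ρ * Ring.inverse a) (𝓝[S] 1) = 𝓝[O] ρ) :
    ∃ L, IsParametrization (fun X : 𝔪 => cay (X : A) * ρ * cay (-(X : A))) L O := by
  refine ⟨-(2 : ℝ) • (((ContinuousLinearMap.mul ℝ A).flip ρ - ContinuousLinearMap.mul ℝ A ρ) ∘L
    𝔪.subtypeL), ?_, ?_, ?_, ?_⟩
  · filter_upwards [eventually_isUnit_one_add 𝔪] with X hX
    have h1 : ContDiffAt ℝ ∞ (fun X : 𝔪 => cay (X : A)) X :=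
      (contDiffAt_cay hX.1).comp X 𝔪.subtypeL.contDiff.contDiffAt
    have h2 : ContDiffAt ℝ ∞ (fun X : 𝔪 => cay (-(X : A))) X :=
      ContDiffAt.comp X (contDiffAt_cay (by simpa [← sub_eq_add_neg] using hX.2))
        (-𝔪.subtypeL).contDiff.contDiffAt
    exact (h1.mul contDiffAt_const).mul h2
  · have h1 := hasFDerivAt_cay_subtype 𝔪
    have h0 : HasFDerivAt cay (-(2 : ℝ) • ContinuousLinearMap.id ℝ A) ((-𝔪.subtypeL) 0) := by
      simpa using (hasStrictFDerivAt_cay_zero (A := A)).hasFDerivAt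
    have h2 : HasFDerivAt (fun X : 𝔪 => cay (-(X : A))) _ 0 :=
      h0.comp (0 : 𝔪) (-𝔪.subtypeL).hasFDerivAt
    convert! (h1.mul_const' ρ).mul' h2 using 1
    ext X
    simp [cay_zero, smul_sub]
    abel
  · rw [injective_iff_map_eq_zero]
    intro X hX
    have hX' : -(2 : ℝ) • ((X : A) * ρ - ρ * X) = 0 := hX
    rw [smul_eq_zero, or_iff_right (by norm_num), sub_eq_zero] at hX'
    exact Subtype.ext (hm X X.2 hX')
  · have hfst : map (Prod.fst : 𝔪 × 𝔨 → 𝔪) (𝓝 0) = 𝓝 0 := map_fst_nhds (0 : 𝔪 × 𝔨)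
    -- The factor from `𝔨` commutes with `ρ` and cancels, so the conjugate depends on the `𝔪`
    -- component alone.
    have hev : (fun a => a * ρ * Ring.inverse a) ∘
        (fun p : 𝔪 × 𝔨 => cay (p.1 : A) * cay (p.2 : A)) =ᶠ[𝓝 0]
        (fun X : 𝔪 => cay (X : A) * ρ * cay (-(X : A))) ∘ Prod.fst := by
      have e1 : ∀ᶠ p : 𝔪 × 𝔨 in 𝓝 0, IsUnit (1 + (p.1 : A)) ∧ IsUnit (1 - (p.1 : A)) :=
        (continuous_fst.tendsto (0 : 𝔪 × 𝔨)).eventually (eventually_isUnit_one_add 𝔪)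
      have e2 : ∀ᶠ p : 𝔪 × 𝔨 in 𝓝 0, IsUnit (1 + (p.2 : A)) ∧ IsUnit (1 - (p.2 : A)) :=
        (continuous_snd.tendsto (0 : 𝔪 × 𝔨)).eventually (eventually_isUnit_one_add 𝔨)
      filter_upwards [e1, e2] with p h1 h2
      have h3 : IsUnit (cay (p.1 : A)) :=
        ⟨⟨_, _, cay_mul_cay_neg h1.1 h1.2, cay_neg_mul_cay h1.1 h1.2⟩, rfl⟩
      have h4 : cay (p.2 : A) * ρ = ρ * cay (p.2 : A) :=
        cay_mul_eq_mul_cay h2.1 h2.1 (hk _ p.2.2)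
      simp only [Function.comp_apply]
      rw [Ring.inverse_mul (Or.inl h3), inverse_cay h1.1 h1.2, inverse_cay h2.1 h2.2,
        mul_assoc (cay (p.1 : A)), h4]
      calc cay (p.1 : A) * (ρ * cay (p.2 : A)) * (cay (-(p.2 : A)) * cay (-(p.1 : A)))
          = cay (p.1 : A) * (ρ * (cay (p.2 : A) * cay (-(p.2 : A)))) * cay (-(p.1 : A)) := by
            noncomm_ring
        _ = _ := by rw [cay_mul_cay_neg h2.1 h2.2, mul_one]
    rw [← hfst, map_map, ← map_congr hev, ← map_map, h.map_cay_mul_cay hmk, hO]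
    simp [cay_zero]

end Cayley

end

/-! ### Orbits of compact groups -/

section

open Filter Topology Set

namespace MulAction

variable {G X : Type*} [Group G] [TopologicalSpace G] [CompactSpace G] [TopologicalSpace X]
  [T2Space X] [MulAction G X]

theorem isHomeomorph_orbitEquivQuotientStabilizer {b : X} (h : Continuous fun g : G => g • b) :
    IsHomeomorph (orbitEquivQuotientStabilizer G b) := by
  have hc : Continuous (orbitEquivQuotientStabilizer G b).symm :=
    Continuous.subtype_mk (h.quotient_lift _) _
  have := (Continuous.homeoOfEquivCompactToT2 hc).symm.isHomeomorph
  exact this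

/-- The orbit map is the open quotient map followed by a continuous bijection from a compact space
to a Hausdorff one. -/
theorem map_nhds_orbit [IsTopologicalGroup G] {b : X} (h : Continuous fun g : G => g • b) :
    map (fun g : G => g • b) (𝓝 1) = 𝓝[orbit G b] b := by
  have h1 : map (QuotientGroup.mk : G → G ⧸ stabilizer G b) (𝓝 1) = 𝓝 ↑(1 : G) :=
    IsOpenMap.map_nhds_eq QuotientGroup.isOpenMap_coe
      (QuotientGroup.continuous_mk).continuousAt
  have hc : Continuous (orbitEquivQuotientStabilizer G b).symm :=
    Continuous.subtype_mk (h.quotient_lift _) _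
  have h2 : map (orbitEquivQuotientStabilizer G b).symm (𝓝 ↑(1 : G)) =
      𝓝 ((orbitEquivQuotientStabilizer G b).symm ↑(1 : G)) :=
    (Continuous.homeoOfEquivCompactToT2 hc).map_nhds_eq _
  have h3 : map (Subtype.val : orbit G b → X)
      (𝓝 ((orbitEquivQuotientStabilizer G b).symm ↑(1 : G))) = 𝓝[orbit G b] b := by
    rw [IsEmbedding.subtypeVal.map_nhds_eq, Subtype.range_coe]
    simp
  calc map (fun g : G => g • b) (𝓝 1)
      = map (Subtype.val ∘ (orbitEquivQuotientStabilizer G b).symm ∘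
          (QuotientGroup.mk : G → G ⧸ stabilizer G b)) (𝓝 1) := rfl
    _ = 𝓝[orbit G b] b := by rw [← map_map, ← map_map, h1, h2, h3]

end MulAction

/-! ### Compactness of the symplectic group and its maximal torus -/

namespace SymplecticOrbit

variable {n : ℕ}

theorem isEmbedding_spMatrix : IsEmbedding (spMatrix : Sp n → _) :=
  IsEmbedding.subtypeVal.comp IsEmbedding.subtypeVal

@[simp] theorem spMatrix_one : spMatrix (1 : Sp n) = 1 := rfl

@[simp] theorem spMatrix_mul (g h : Sp n) : spMatrix (g * h) = spMatrix g * spMatrix h := rfl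

theorem spMatrix_inv (g : Sp n) : spMatrix g⁻¹ = (spMatrix g)ᴴ := rfl

theorem spMatrix_mul_inv (g : Sp n) : spMatrix g * spMatrix g⁻¹ = 1 := by
  rw [← spMatrix_mul, mul_inv_cancel, spMatrix_one]

theorem spMatrix_inv_mul (g : Sp n) : spMatrix g⁻¹ * spMatrix g = 1 := by
  rw [← spMatrix_mul, inv_mul_cancel, spMatrix_one]

theorem spMatrix_transpose_mul_J (g : Sp n) : (spMatrix g)ᵀ * J n * spMatrix g = J n := g.2

theorem coe_smul (g : Sp n) (ρ : DensityMatrix n) :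
    (g • ρ).1 = spMatrix g * ρ.1 * spMatrix g⁻¹ := rfl

theorem mem_range_spMatrix {A : Matrix (Fin n ⊕ Fin n) (Fin n ⊕ Fin n) ℂ} :
    A ∈ range (spMatrix : Sp n → _) ↔ A * Aᴴ = 1 ∧ Aᵀ * J n * A = J n := by
  constructor
  · rintro ⟨g, rfl⟩
    exact ⟨spMatrix_mul_inv g, spMatrix_transpose_mul_J g⟩
  · rintro ⟨h1, h2⟩
    exact ⟨⟨⟨A, Matrix.mem_unitaryGroup_iff.2 h1⟩, h2⟩, rfl⟩

instance : CompactSpace (Sp n) := by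
  rw [← isCompact_univ_iff, isEmbedding_spMatrix.isCompact_iff, image_univ]
  have hK : IsCompact {A : Matrix (Fin n ⊕ Fin n) (Fin n ⊕ Fin n) ℂ |
      ∀ i, A i ∈ {v : Fin n ⊕ Fin n → ℂ | ∀ j, v j ∈ Metric.closedBall (0 : ℂ) 1}} :=
    isCompact_pi_infinite fun _ => isCompact_pi_infinite fun _ => isCompact_closedBall _ _
  refine hK.of_isClosed_subset ?_ ?_
  · have : range (spMatrix : Sp n → _) = {A | A * Aᴴ = 1} ∩ {A | Aᵀ * J n * A = J n} := by
      ext A; exact mem_range_spMatrix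
    rw [this]
    exact (isClosed_eq (by fun_prop) continuous_const).inter
      (isClosed_eq (by fun_prop) continuous_const)
  · rintro _ ⟨g, rfl⟩ i j
    exact mem_closedBall_zero_iff.2 (entry_norm_bound_of_unitary g.1.2 i j)

theorem continuous_smul_const (ρ : DensityMatrix n) : Continuous fun g : Sp n => g • ρ := by
  rw [continuous_induced_rng]
  have h : Continuous (spMatrix : Sp n → _) := isEmbedding_spMatrix.continuous
  exact (h.matrix_mul continuous_const).matrix_mul (h.comp continuous_inv)

section Torus

theorem spMatrix_torusHom (z : Fin n → Circle) : spMatrix (torusHom n z) =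
    Matrix.diagonal (Sum.elim (fun i => (z i : ℂ)) fun i => star (z i : ℂ)) := rfl

theorem torusHom_injective : Function.Injective (torusHom n) := by
  intro z w h
  have h1 := congrArg spMatrix h
  rw [spMatrix_torusHom, spMatrix_torusHom, Matrix.diagonal_injective.eq_iff] at h1
  funext i
  exact Circle.ext (congrFun h1 (Sum.inl i))

theorem continuous_torusHom : Continuous (torusHom n) := by
  rw [isEmbedding_spMatrix.continuous_iff]
  refine Continuous.matrix_diagonal (continuous_pi fun i => ?_)
  rcases i with i | i <;> simp only [Sum.elim_inl, Sum.elim_inr] <;> fun_prop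

theorem nonempty_torus_equiv : Nonempty (torus n ≃ₜ* (Fin n → Circle)) := by
  let e : (Fin n → Circle) ≃* torus n := MonoidHom.ofInjective torusHom_injective
  have he : Continuous e := continuous_torusHom.subtype_mk _
  exact ⟨{ e.symm with
    continuous_toFun := (Continuous.homeoOfEquivCompactToT2 (f := e.toEquiv) he).symm.continuous
    continuous_invFun := he }⟩

theorem _root_.Circle.exists_coe_eq {w : ℂ} (hw : ‖w‖ = 1) : ∃ c : Circle, (c : ℂ) = w :=
  ⟨⟨w, mem_sphere_zero_iff_norm.2 hw⟩, rfl⟩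

/-- An element of `Sp(n)` which commutes with the diagonal torus is diagonal. -/
theorem isDiag_of_commute_torus {g : Sp n} (h : ∀ t ∈ torus n, t * g = g * t) :
    (spMatrix g).IsDiag := by
  intro i j hij
  let k : Fin n := Sum.elim id id i
  obtain ⟨c, hc⟩ := Circle.exists_coe_eq Complex.norm_I
  -- The diagonal entries of this torus element are `I` and `-I` at the two copies of `k` and `1`
  -- elsewhere, so those at `i` and `j` differ and the `(i, j)` entry of `g` must vanish.
  let z : Fin n → Circle := Function.update 1 k c
  have h1 := congrArg spMatrix (h (torusHom n z) ⟨z, rfl⟩)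
  rw [spMatrix_mul, spMatrix_mul, spMatrix_torusHom] at h1
  have h2 := congrFun (congrFun h1 i) j
  rw [Matrix.diagonal_mul, Matrix.mul_diagonal, mul_comm, ← sub_eq_zero, ← mul_sub] at h2
  refine (mul_eq_zero.1 h2).resolve_right ?_
  have hI2 : -Complex.I ≠ Complex.I := fun hh => by
    have := congrArg Complex.im hh; norm_num at this
  have hI3 : Complex.I ≠ 1 := fun hh => by
    have := congrArg Complex.im hh; norm_num at this
  have hI4 : -Complex.I ≠ 1 := fun hh => by
    have := congrArg Complex.im hh; norm_num at this
  refine sub_ne_zero.2 ?_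
  rcases i with i | i <;> rcases j with j | j <;> by_cases hj : j = i <;>
    simp_all [z, k, Function.update_apply]
  exact fun hh => hI2 hh.symm

/-- Unitarity makes the entries unimodular; preserving `J n` makes the entries at paired indices
inverse, hence conjugate. -/
theorem mem_torus_of_isDiag {g : Sp n} (h : (spMatrix g).IsDiag) : g ∈ torus n := by
  set d := (spMatrix g).diag with hd
  have hg : spMatrix g = Matrix.diagonal d := h.diagonal_diag.symm
  have h1 := spMatrix_mul_inv g
  rw [spMatrix_inv, hg, Matrix.diagonal_conjTranspose, Matrix.diagonal_mul_diagonal,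
    ← Matrix.diagonal_one, Matrix.diagonal_injective.eq_iff] at h1
  have hnorm : ∀ i, ‖d i‖ = 1 := fun i => by
    have h2 : d i * star (d i) = 1 := congrFun h1 i
    have h3 := congrArg norm h2
    rw [norm_mul, norm_star, norm_one] at h3
    nlinarith [norm_nonneg (d i)]
  have h4 := spMatrix_transpose_mul_J g
  rw [hg, Matrix.diagonal_transpose] at h4
  have h5 : ∀ i : Fin n, d (Sum.inl i) * d (Sum.inr i) = 1 := fun i => by
    have := congrFun (congrFun h4 (Sum.inl i)) (Sum.inr i)
    rw [Matrix.mul_diagonal, Matrix.diagonal_mul] at this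
    simpa [J] using this
  choose z hz using fun i : Fin n => Circle.exists_coe_eq (hnorm (Sum.inl i))
  refine ⟨z, ?_⟩
  refine isEmbedding_spMatrix.injective ?_
  rw [spMatrix_torusHom, hg]
  congr 1
  funext i
  rcases i with i | i
  · exact hz i
  · simp only [Sum.elim_inr, hz]
    have h6 : d (Sum.inl i) * star (d (Sum.inl i)) = 1 := congrFun h1 (Sum.inl i)
    have h7 : d (Sum.inl i) ≠ 0 := left_ne_zero_of_mul_eq_one h6
    exact mul_left_cancel₀ h7 (h6.trans (h5 i).symm)

theorem isMaximalTorus_torus : IsMaximalTorus (torus n) := by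
  refine ⟨⟨n, nonempty_torus_equiv⟩, ?_⟩
  rintro T ⟨k, ⟨e⟩⟩ hT g hg
  refine mem_torus_of_isDiag (isDiag_of_commute_torus fun t ht => ?_)
  have h : (⟨t, hT ht⟩ : T) * ⟨g, hg⟩ = ⟨g, hg⟩ * ⟨t, hT ht⟩ := by
    apply e.injective
    rw [map_mul, map_mul, mul_comm]
  exact congrArg Subtype.val h

theorem torus_le_stabilizer {ρ : DensityMatrix n} (hρ : ρ.1.IsDiag) :
    torus n ≤ MulAction.stabilizer (Sp n) ρ := by
  rintro _ ⟨z, rfl⟩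
  rw [MulAction.mem_stabilizer_iff]
  apply Subtype.ext
  rw [coe_smul]
  have h : spMatrix (torusHom n z) * ρ.1 = ρ.1 * spMatrix (torusHom n z) := by
    rw [spMatrix_torusHom, ← hρ.diagonal_diag, Matrix.diagonal_mul_diagonal,
      Matrix.diagonal_mul_diagonal]
    simp only [mul_comm]
  rw [h, Matrix.mul_assoc, spMatrix_mul_inv, Matrix.mul_one]

end Torus

end SymplecticOrbit

end

/-! ### The Lie algebra, the dimension bound and the embedded manifolds -/

section

open Filter Topology Set EmbeddedSubmanifold Cayley

theorem Manifold.IsSmoothEmbedding.contMDiff_iff_comp {𝕜 : Type*} [NontriviallyNormedField 𝕜]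
    {E₁ E₂ E₃ H₁ H₂ H₃ M N P : Type*} [NormedAddCommGroup E₁] [NormedSpace 𝕜 E₁]
    [NormedAddCommGroup E₂] [NormedSpace 𝕜 E₂] [NormedAddCommGroup E₃] [NormedSpace 𝕜 E₃]
    [TopologicalSpace H₁] [TopologicalSpace H₂] [TopologicalSpace H₃]
    {I₁ : ModelWithCorners 𝕜 E₁ H₁} {I₂ : ModelWithCorners 𝕜 E₂ H₂} {I₃ : ModelWithCorners 𝕜 E₃ H₃}
    [TopologicalSpace M] [ChartedSpace H₁ M] [TopologicalSpace N] [ChartedSpace H₂ N]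
    [TopologicalSpace P] [ChartedSpace H₃ P] [IsManifold I₁ ∞ M] [IsManifold I₂ ∞ N]
    [IsManifold I₃ ∞ P] {φ : N → P} (hφ : IsSmoothEmbedding I₂ I₃ ∞ φ) {f : M → N} :
    ContMDiff I₁ I₂ ∞ f ↔ ContMDiff I₁ I₃ ∞ (φ ∘ f) := by
  rw [ContMDiff.iff_comp_isImmersion hφ.isImmersion, and_iff_right_iff_imp]
  exact fun h => hφ.isEmbedding.continuous_iff.2 h.continuous

namespace SymplecticOrbit

variable {n : ℕ}

/-- The Lie algebra of `Sp(n)`. -/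
def lieSp (n : ℕ) : Submodule ℝ (Matrix (Fin n ⊕ Fin n) (Fin n ⊕ Fin n) ℂ) where
  carrier := {X | Xᴴ = -X ∧ Xᵀ * J n = J n * -X}
  add_mem' := by
    rintro X Y ⟨h1, h2⟩ ⟨h3, h4⟩
    exact ⟨by rw [Matrix.conjTranspose_add, h1, h3, neg_add],
      by rw [Matrix.transpose_add, Matrix.add_mul, h2, h4, neg_add, Matrix.mul_add]⟩
  zero_mem' := by simp
  smul_mem' := by
    rintro c X ⟨h1, h2⟩
    exact ⟨by rw [Matrix.conjTranspose_smul, h1, smul_neg, star_trivial],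
      by rw [Matrix.transpose_smul, Matrix.smul_mul, h2, ← smul_neg, Matrix.mul_smul]⟩

theorem conjTranspose_cay (X : Matrix (Fin n ⊕ Fin n) (Fin n ⊕ Fin n) ℂ) :
    (cay X)ᴴ = cay Xᴴ := by
  have h : star (Ring.inverse (1 + X)) = Ring.inverse (1 + star X) := by
    rw [← Ring.inverse_star, star_add, star_one]
  change star (2 * Ring.inverse (1 + X) - 1) = 2 * Ring.inverse (1 + star X) - 1
  rw [star_sub, star_one, two_mul, star_add, h, two_mul]

theorem transpose_cay (X : Matrix (Fin n ⊕ Fin n) (Fin n ⊕ Fin n) ℂ) :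
    (cay X)ᵀ = cay Xᵀ := by
  rw [cay, cay, two_mul, two_mul, ← Matrix.nonsing_inv_eq_ringInverse,
    ← Matrix.nonsing_inv_eq_ringInverse, Matrix.transpose_sub, Matrix.transpose_add,
    Matrix.transpose_nonsing_inv, Matrix.transpose_add, Matrix.transpose_one]

/-- An element of the Lie algebra which vanishes at the positions of a fundamental system of
off-diagonal entries is diagonal. -/
theorem isDiag_of_mem_lieSp {X : Matrix (Fin n ⊕ Fin n) (Fin n ⊕ Fin n) ℂ} (hX : X ∈ lieSp n)
    (hA : ∀ i j, i < j → X (Sum.inl i) (Sum.inl j) = 0)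
    (hB : ∀ i j, j ≤ i → X (Sum.inl i) (Sum.inr j) = 0) : X.IsDiag := by
  have hs : ∀ i j, X i j = 0 → X j i = 0 := fun i j h => by
    have := congrFun (congrFun hX.1 j) i
    rw [Matrix.conjTranspose_apply, h, star_zero] at this
    exact neg_eq_zero.1 this.symm
  have hJ := hX.2
  rw [← Matrix.fromBlocks_toBlocks X, J, Matrix.fromBlocks_transpose, Matrix.fromBlocks_neg,
    Matrix.fromBlocks_multiply, Matrix.fromBlocks_multiply, Matrix.fromBlocks_inj] at hJ
  simp only [Matrix.mul_zero, Matrix.zero_mul, Matrix.mul_one, Matrix.one_mul, zero_add, add_zero,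
    Matrix.mul_neg, Matrix.neg_mul, neg_zero, neg_neg] at hJ
  obtain ⟨-, h2, -, h4⟩ := hJ
  have hA' : ∀ i j, i ≠ j → X (Sum.inl i) (Sum.inl j) = 0 := fun i j hij =>
    (lt_or_gt_of_ne hij).elim (hA i j) fun h => hs _ _ (hA j i h)
  have hB' : ∀ i j, X (Sum.inl i) (Sum.inr j) = 0 := fun i j => by
    rcases le_total j i with h | h
    · exact hB i j h
    · have := congrFun (congrFun h4 j) i
      rw [Matrix.transpose_apply] at this
      exact this.trans (hB j i h)
  have hD : ∀ i j, i ≠ j → X (Sum.inr i) (Sum.inr j) = 0 := fun i j hij => by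
    have := congrFun (congrFun h2 i) j
    rw [Matrix.transpose_apply] at this
    exact neg_eq_zero.1 (this.symm.trans (hA' j i hij.symm))
  rintro (i | i) (j | j) hij
  · exact hA' i j fun h => hij (congrArg _ h)
  · exact hB' i j
  · exact hs _ _ (hB' j i)
  · exact hD i j fun h => hij (congrArg _ h)

theorem finrank_le_of_disjoint_diag {𝔪 : Submodule ℝ (Matrix (Fin n ⊕ Fin n) (Fin n ⊕ Fin n) ℂ)}
    (hm : 𝔪 ≤ lieSp n) (hd : ∀ X ∈ 𝔪, X.IsDiag → X = 0) : Module.finrank ℝ 𝔪 ≤ 2 * n ^ 2 := by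
  let φ : 𝔪 →ₗ[ℝ] (Fin n → Fin n → ℂ) :=
    -- One `n × n` array stores the strict upper triangle of the upper left block and the lower
    -- triangle, with diagonal, of the upper right block.
    { toFun := fun X i j => X.1 (Sum.inl i) (if i < j then Sum.inl j else Sum.inr j)
      map_add' := fun X Y => rfl
      map_smul' := fun c X => rfl }
  have hφ : Function.Injective φ := by
    rw [injective_iff_map_eq_zero]
    intro X hX
    have h : ∀ i j, X.1 (Sum.inl i) (if i < j then Sum.inl j else Sum.inr j) = 0 :=
      fun i j => congrFun (congrFun hX i) j
    refine Subtype.ext (hd X X.2 (isDiag_of_mem_lieSp (hm X.2) (fun i j hij => ?_)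
      fun i j hij => ?_))
    · simpa [hij] using h i j
    · simpa [not_lt.2 hij] using h i j
  refine (LinearMap.finrank_le_finrank_of_injective hφ).trans_eq ?_
  rw [Module.finrank_pi_fintype]
  simp [Module.finrank_pi_fintype, Complex.finrank_real_complex]
  ring

theorem exists_complement_stabilizer (ρ : Matrix (Fin n ⊕ Fin n) (Fin n ⊕ Fin n) ℂ) :
    ∃ 𝔪 𝔨 : Submodule ℝ (Matrix (Fin n ⊕ Fin n) (Fin n ⊕ Fin n) ℂ), 𝔪 ⊔ 𝔨 = lieSp n ∧
      (∀ X ∈ 𝔨, X * ρ = ρ * X) ∧ ∀ X ∈ 𝔪, X * ρ = ρ * X → X = 0 := by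
  let 𝔷 : Submodule ℝ (Matrix (Fin n ⊕ Fin n) (Fin n ⊕ Fin n) ℂ) :=
    { carrier := {X | X * ρ = ρ * X}
      add_mem' := fun {X Y} (hX : _ = _) (hY : _ = _) => by
        change (X + Y) * ρ = ρ * (X + Y)
        rw [Matrix.add_mul, Matrix.mul_add, hX, hY]
      zero_mem' := by simp
      smul_mem' := fun c X (hX : _ = _) => by
        change (c • X) * ρ = ρ * (c • X)
        rw [Matrix.smul_mul, Matrix.mul_smul, hX] }
  obtain ⟨𝔠, h𝔠⟩ := Submodule.exists_isCompl (lieSp n ⊓ 𝔷)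
  refine ⟨𝔠 ⊓ lieSp n, lieSp n ⊓ 𝔷, ?_, fun X hX => hX.2, fun X hX hXρ => ?_⟩
  -- The modular law turns a complement in all matrices into one inside `lieSp n`.
  · rw [sup_comm, ← sup_inf_assoc_of_le _ inf_le_left, h𝔠.sup_eq_top, top_inf_eq]
  · have : X ∈ (lieSp n ⊓ 𝔷) ⊓ 𝔠 := ⟨⟨hX.2, hXρ⟩, hX.1⟩
    rw [h𝔠.inf_eq_bot] at this
    exact this

/-- The map `X ↦ g X h⁻¹`, from matrices to doubly indexed families. -/
def mulMulInv (g h : Sp n) : Matrix (Fin n ⊕ Fin n) (Fin n ⊕ Fin n) ℂ ≃ₗ[ℝ]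
    (Fin n ⊕ Fin n → Fin n ⊕ Fin n → ℂ) where
  toFun X i j := (spMatrix g * X * spMatrix h⁻¹) i j
  invFun X := spMatrix g⁻¹ * Matrix.of X * spMatrix h
  map_add' X Y := by
    rw [Matrix.mul_add, Matrix.add_mul]; rfl
  map_smul' c X := by
    rw [Matrix.mul_smul, Matrix.smul_mul]; rfl
  left_inv X := by
    change spMatrix g⁻¹ * (spMatrix g * X * spMatrix h⁻¹) * spMatrix h = X
    calc spMatrix g⁻¹ * (spMatrix g * X * spMatrix h⁻¹) * spMatrix h
        = (spMatrix g⁻¹ * spMatrix g) * X * (spMatrix h⁻¹ * spMatrix h) := by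
          simp only [Matrix.mul_assoc]
      _ = X := by rw [spMatrix_inv_mul, spMatrix_inv_mul, Matrix.one_mul, Matrix.mul_one]
  right_inv X := by
    change spMatrix g * (spMatrix g⁻¹ * Matrix.of X * spMatrix h) * spMatrix h⁻¹ = Matrix.of X
    calc spMatrix g * (spMatrix g⁻¹ * Matrix.of X * spMatrix h) * spMatrix h⁻¹
        = (spMatrix g * spMatrix g⁻¹) * Matrix.of X * (spMatrix h * spMatrix h⁻¹) := by
          simp only [Matrix.mul_assoc]
      _ = Matrix.of X := by
          rw [spMatrix_mul_inv, spMatrix_mul_inv, Matrix.one_mul, Matrix.mul_one]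

section Norm

open scoped Matrix.Norms.L2Operator

/-- The transform commutes with both transposes, so the condition `Xᴴ = -X` corresponds to unitarity
and `Xᵀ * J n = J n * -X` to preserving `J n`. The operator norm supplies the Banach algebra
structure. -/
theorem isCayleyGroup_sp : IsCayleyGroup (lieSp n) (range (spMatrix : Sp n → _)) where
  cay_mem X hX hu := by
    have hu' : IsUnit (1 - X) := by
      have := hu.star
      rwa [star_add, star_one, Matrix.star_eq_conjTranspose, hX.1, ← sub_eq_add_neg] at this
    rw [mem_range_spMatrix, conjTranspose_cay, hX.1, transpose_cay,
      cay_mul_eq_mul_cay (b := -X) _ (by rwa [← sub_eq_add_neg]) hX.2, Matrix.mul_assoc,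
      cay_neg_mul_cay hu hu', Matrix.mul_one]
    · exact ⟨cay_mul_cay_neg hu hu', rfl⟩
    · have := (Matrix.isUnit_transpose (1 + X)).2 hu
      rwa [Matrix.transpose_add, Matrix.transpose_one] at this
  cay_mem' := by
    rintro _ ⟨g, rfl⟩ hu
    set a := spMatrix g with ha
    have h1 : a * aᴴ = 1 := spMatrix_mul_inv g
    have h2 : aᴴ * a = 1 := spMatrix_inv_mul g
    have hu1 : IsUnit (1 + aᴴ) := by
      have := hu.star
      rwa [star_add, star_one, Matrix.star_eq_conjTranspose] at this
    have hu2 : IsUnit (1 + aᵀ) := by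
      have := (Matrix.isUnit_transpose (1 + a)).2 hu
      rwa [Matrix.transpose_add, Matrix.transpose_one] at this
    have h3 : aᵀ * J n = J n * aᴴ := by
      calc aᵀ * J n = aᵀ * J n * a * aᴴ := by rw [Matrix.mul_assoc, h1, Matrix.mul_one]
        _ = J n * aᴴ := by rw [ha, spMatrix_transpose_mul_J]
    have h4 : cay aᴴ = -cay a := cay_eq_neg_of_mul_eq_one h2 hu hu1
    exact ⟨by rw [conjTranspose_cay, h4],
      by rw [transpose_cay, cay_mul_eq_mul_cay hu2 hu1 h3, h4]⟩
  mul_mem := by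
    rintro _ ⟨g, rfl⟩ _ ⟨h, rfl⟩
    exact ⟨g * h, rfl⟩

theorem map_conj_nhdsWithin (ρ : DensityMatrix n) :
    map (fun a => a * ρ.1 * Ring.inverse a) (𝓝[range (spMatrix : Sp n → _)] 1) =
      𝓝[Subtype.val '' MulAction.orbit (Sp n) ρ] ρ.1 := by
  have h1 : map (spMatrix : Sp n → _) (𝓝 1) = 𝓝[range (spMatrix : Sp n → _)] 1 :=
    isEmbedding_spMatrix.map_nhds_eq 1
  have h2 : map (Subtype.val : DensityMatrix n → _) (𝓝[MulAction.orbit (Sp n) ρ] ρ) =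
      𝓝[Subtype.val '' MulAction.orbit (Sp n) ρ] ρ.1 :=
    IsEmbedding.subtypeVal.map_nhdsWithin_eq _ _
  have h3 : (fun a => a * ρ.1 * Ring.inverse a) ∘ (spMatrix : Sp n → _) =
      Subtype.val ∘ fun g : Sp n => g • ρ := by
    funext g
    have : Ring.inverse (spMatrix g) = spMatrix g⁻¹ :=
      Ring.inverse_unit ⟨spMatrix g, spMatrix g⁻¹, spMatrix_mul_inv g, spMatrix_inv_mul g⟩
    simp only [Function.comp_apply, this, coe_smul]
  rw [← h1, map_map, h3, ← map_map, MulAction.map_nhds_orbit (continuous_smul_const ρ), h2]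

theorem exists_isSmoothEmbedding_sp (n : ℕ) :
    ∃ (k : ℕ) (_ : ChartedSpace (EuclideanSpace ℝ (Fin k)) (Sp n)), IsManifold (𝓡 k) ∞ (Sp n) ∧
      Manifold.IsSmoothEmbedding (𝓡 k) 𝓘(ℝ, Fin n ⊕ Fin n → Fin n ⊕ Fin n → ℂ) ∞
        (fun (g : Sp n) i j => spMatrix g i j) := by
  refine ⟨Module.finrank ℝ (lieSp n), ?_⟩
  let e : EuclideanSpace ℝ (Fin (Module.finrank ℝ (lieSp n))) ≃L[ℝ] lieSp n :=
    ContinuousLinearEquiv.ofFinrankEq finrank_euclideanSpace_fin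
  refine exists_isSmoothEmbedding isEmbedding_spMatrix fun g => ?_
  -- Left translation by `g`, which also passes from the operator norm to the norm on families.
  have h := isCayleyGroup_sp.isParametrization.comp_equiv e (mulMulInv g 1).toContinuousLinearEquiv
  have hS : (mulMulInv g 1).toContinuousLinearEquiv '' range (spMatrix : Sp n → _) =
      range fun (g : Sp n) i j => spMatrix g i j := by
    rw [← range_comp]
    change range (fun x : Sp n => (spMatrix g * spMatrix x * spMatrix 1⁻¹ :)) =
      range fun x : Sp n => spMatrix x
    refine Subset.antisymm ?_ ?_
    · rintro _ ⟨x, rfl⟩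
      exact ⟨g * x * 1⁻¹, rfl⟩
    · rintro _ ⟨x, rfl⟩
      refine ⟨g⁻¹ * x, ?_⟩
      change spMatrix (g * (g⁻¹ * x) * 1⁻¹) = spMatrix x
      simp
  rw [hS] at h
  refine ⟨_, _, ?_, h⟩
  have h0 : spMatrix g * cay ((e 0 : lieSp n) : Matrix _ _ ℂ) * spMatrix 1⁻¹ = spMatrix g := by
    simp [cay_zero]
  exact h0

theorem isEmbedding_orbit (ρ : DensityMatrix n) :
    IsEmbedding fun (σ : MulAction.orbit (Sp n) ρ) i j => σ.1.1 i j := by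
  have h : IsEmbedding (Subtype.val : DensityMatrix n → _) := .subtypeVal
  exact h.comp IsEmbedding.subtypeVal

theorem exists_isSmoothEmbedding_orbit {ρ : DensityMatrix n} (hρ : ρ.1.IsDiag) :
    ∃ d ≤ 2 * n ^ 2, ∃ _ : ChartedSpace (EuclideanSpace ℝ (Fin d)) (MulAction.orbit (Sp n) ρ),
      IsManifold (𝓡 d) ∞ (MulAction.orbit (Sp n) ρ) ∧
      Manifold.IsSmoothEmbedding (𝓡 d) 𝓘(ℝ, Fin n ⊕ Fin n → Fin n ⊕ Fin n → ℂ) ∞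
        (fun (σ : MulAction.orbit (Sp n) ρ) i j => σ.1.1 i j) := by
  obtain ⟨𝔪, 𝔨, hmk, hk, hm⟩ := exists_complement_stabilizer ρ.1
  refine ⟨Module.finrank ℝ 𝔪, finrank_le_of_disjoint_diag (hmk ▸ le_sup_left) ?_, ?_⟩
  -- Diagonality of `ρ` enters here: a diagonal `X` commutes with it, so it vanishes if it lies in
  -- `𝔪`.
  · intro X hX hd
    refine hm X hX ?_
    rw [← hρ.diagonal_diag, ← hd.diagonal_diag, Matrix.diagonal_mul_diagonal,
      Matrix.diagonal_mul_diagonal]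
    simp only [mul_comm]
  let e : EuclideanSpace ℝ (Fin (Module.finrank ℝ 𝔪)) ≃L[ℝ] 𝔪 :=
    ContinuousLinearEquiv.ofFinrankEq finrank_euclideanSpace_fin
  obtain ⟨L, hL⟩ := isCayleyGroup_sp.isParametrization_orbit hmk hk hm (map_conj_nhdsWithin ρ)
  refine exists_isSmoothEmbedding (isEmbedding_orbit ρ) ?_
  rintro ⟨_, g, rfl⟩
  have h := hL.comp_equiv e (mulMulInv g g).toContinuousLinearEquiv
  have hS : (mulMulInv g g).toContinuousLinearEquiv '' (Subtype.val '' MulAction.orbit (Sp n) ρ) =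
      range fun (σ : MulAction.orbit (Sp n) ρ) i j => σ.1.1 i j := by
    let v : DensityMatrix n → Fin n ⊕ Fin n → Fin n ⊕ Fin n → ℂ := fun σ i j => σ.1 i j
    have hv : ∀ σ : DensityMatrix n, (mulMulInv g g).toContinuousLinearEquiv σ.1 = v (g • σ) :=
      fun _ => rfl
    have hg : (fun σ => g • σ) '' MulAction.orbit (Sp n) ρ = MulAction.orbit (Sp n) ρ :=
      MulAction.smul_orbit g ρ
    calc (mulMulInv g g).toContinuousLinearEquiv '' (Subtype.val '' MulAction.orbit (Sp n) ρ)
        = v '' ((fun σ => g • σ) '' MulAction.orbit (Sp n) ρ) := by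
          rw [image_image, image_image]
          exact image_congr fun σ _ => hv σ
      _ = v '' MulAction.orbit (Sp n) ρ := by rw [hg]
      _ = range (v ∘ Subtype.val) := by rw [range_comp, Subtype.range_coe]
  rw [hS] at h
  refine ⟨_, _, ?_, h⟩
  have h0 : spMatrix g * (cay ((e 0 : 𝔪) : Matrix _ _ ℂ) * ρ.1 *
      cay (-((e 0 : 𝔪) : Matrix _ _ ℂ))) * spMatrix g⁻¹ = spMatrix g * ρ.1 * spMatrix g⁻¹ := by
    simp [cay_zero]
  exact h0

end Norm

end SymplecticOrbit

end

/-! ### Smoothness of the group operations and of the action -/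

section

namespace SymplecticOrbit

theorem contDiff_matrix_mul (ι : Type*) [Fintype ι] :
    ContDiff ℝ ∞ fun (p : (ι → ι → ℂ) × (ι → ι → ℂ)) (i j : ι) => ∑ k, p.1 i k * p.2 k j := by
  fun_prop

theorem contDiff_conjTranspose (ι : Type*) [Fintype ι] :
    ContDiff ℝ ∞ fun (M : ι → ι → ℂ) (i j : ι) => star (M j i) :=
  contDiff_pi.2 fun i => contDiff_pi.2 fun j =>
    Complex.conjCLE.contDiff.comp (by fun_prop : ContDiff ℝ ∞ fun M : ι → ι → ℂ => M j i)

variable {n : ℕ} {H M E : Type*} [NormedAddCommGroup E] [NormedSpace ℝ E] [TopologicalSpace H]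
  {I : ModelWithCorners ℝ E H} [TopologicalSpace M] [ChartedSpace H M]

theorem contMDiff_matrix_mul {ι : Type*} [Fintype ι] {f g : M → Matrix ι ι ℂ}
    (hf : ContMDiff I 𝓘(ℝ, ι → ι → ℂ) ∞ fun m i j => f m i j)
    (hg : ContMDiff I 𝓘(ℝ, ι → ι → ℂ) ∞ fun m i j => g m i j) :
    ContMDiff I 𝓘(ℝ, ι → ι → ℂ) ∞ fun m i j => (f m * g m) i j :=
  (contDiff_matrix_mul ι).contMDiff.comp (hf.prodMk_space hg)

theorem contMDiff_conjTranspose {ι : Type*} [Fintype ι] {f : M → Matrix ι ι ℂ}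
    (hf : ContMDiff I 𝓘(ℝ, ι → ι → ℂ) ∞ fun m i j => f m i j) :
    ContMDiff I 𝓘(ℝ, ι → ι → ℂ) ∞ fun m i j => (f m)ᴴ i j :=
  (contDiff_conjTranspose ι).contMDiff.comp hf

theorem exists_orbitIsHomogeneousManifold {ρ : DensityMatrix n} (hρ : ρ.1.IsDiag) :
    ∃ d ≤ 2 * n ^ 2, OrbitIsHomogeneousManifold ρ d := by
  obtain ⟨k, C, hM, hι⟩ := exists_isSmoothEmbedding_sp n
  obtain ⟨d, hd, C', hM', hι'⟩ := exists_isSmoothEmbedding_orbit hρ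
  refine ⟨d, hd, k, C, C', ?_, hι, hM', hι', ?_, inferInstance,
    MulAction.isHomeomorph_orbitEquivQuotientStabilizer (continuous_smul_const ρ)⟩
  · exact
    { contMDiff_mul := hι.contMDiff_iff_comp.2 <|
        contMDiff_matrix_mul (f := fun p : Sp n × Sp n => spMatrix p.1)
          (g := fun p => spMatrix p.2) (hι.contMDiff.comp contMDiff_fst)
          (hι.contMDiff.comp contMDiff_snd)
      -- Inversion on unitary matrices is the conjugate transpose, which is real linear.
      contMDiff_inv := hι.contMDiff_iff_comp.2 <|
        contMDiff_conjTranspose (f := spMatrix) hι.contMDiff }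
  · have h1 : ContMDiff ((𝓡 k).prod (𝓡 d)) 𝓘(ℝ, Fin n ⊕ Fin n → Fin n ⊕ Fin n → ℂ) ∞
        fun (p : Sp n × MulAction.orbit (Sp n) ρ) i j => spMatrix p.1 i j :=
      hι.contMDiff.comp contMDiff_fst
    have h2 : ContMDiff ((𝓡 k).prod (𝓡 d)) 𝓘(ℝ, Fin n ⊕ Fin n → Fin n ⊕ Fin n → ℂ) ∞
        fun (p : Sp n × MulAction.orbit (Sp n) ρ) i j => p.2.1.1 i j :=
      hι'.contMDiff.comp contMDiff_snd
    exact ⟨hι'.contMDiff_iff_comp.2 <|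
      contMDiff_matrix_mul (contMDiff_matrix_mul h1 h2) (contMDiff_conjTranspose h1)⟩

end SymplecticOrbit

end

theorem proposition4p2 (n : ℕ) (ρ : SymplecticOrbit.DensityMatrix n) (hρ : ρ.1.IsDiag) :
    (Nonempty (SymplecticOrbit.torus n ≃ₜ* (Fin n → Circle)) ∧
      SymplecticOrbit.IsMaximalTorus (SymplecticOrbit.torus n) ∧
      SymplecticOrbit.torus n ≤ MulAction.stabilizer (SymplecticOrbit.Sp n) ρ) ∧
    ∃ d : ℕ, d ≤ 2 * n ^ 2 ∧ SymplecticOrbit.OrbitIsHomogeneousManifold ρ d :=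
  ⟨⟨SymplecticOrbit.nonempty_torus_equiv, SymplecticOrbit.isMaximalTorus_torus,
    SymplecticOrbit.torus_le_stabilizer hρ⟩, SymplecticOrbit.exists_orbitIsHomogeneousManifold hρ⟩
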